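/- Let $R$ be the ring of lower triangular matrices $\begin{pmatrix} q & 0\\ r & s\end{pmatrix}$ with $q\in\mathbb{Q}$ and $r,s\in\mathbb{R}$. For modules $M,N$ on the same side over $R$, call $M$ $N$-injective if every homomorphism from a submodule of $N$ to $M$ extends to $N$, and $N$-projective if for every epimorphism $g:N\to K$ every homomorphism $M\to K$ factors through $g$. The left (right) $i$-profile of $R$ is the collection of all classes $\{N : M \text{ is } N\text{-injective}\}$, and the left (right) $p$-profile is the collection of all classes $\{N : M\text{ is }N\text{-projective}\}$, where $M$ ranges over the left (right) $R$-modules. We say that $R$ has no left (right) $i$-middle class if its left (right) $i$-profile consists only of the class of semisimple modules and the class of all modules; having no left (right) $p$-middle class is defined in the same way with the $p$-profile. Then: 1. $R$ is not semisimple (so the class of semisimple modules and the class of all modules are different); 2. $R$ has no left $i$-middle class; 3. $R$ has no right $p$-middle class and no left $p$-middle class; 4. $R$ is not without right $i$-middle class: its right $i$-profile does not consist only of the class of semisimple modules and the class of all modules. -/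

import Mathlib

universe u v w

/-- The ring of lower triangular matrices `[[q, 0], [r, s]]` with `q` rational and `r, s` real,
as a subring of the real `2 × 2` matrices. -/
def lowerTriRing : Subring (Matrix (Fin 2) (Fin 2) ℝ) where
  carrier := {A | A 0 1 = 0 ∧ ∃ q : ℚ, A 0 0 = (q : ℝ)}
  mul_mem' := by
    rintro A B ⟨hA, q, hq⟩ ⟨hB, p, hp⟩
    refine ⟨?_, q * p, ?_⟩
    · simp [Matrix.mul_apply, Fin.sum_univ_two, hA, hB]
    · simp [Matrix.mul_apply, Fin.sum_univ_two, hA, hq, hp]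
  one_mem' := ⟨by simp, 1, by simp⟩
  add_mem' := by
    rintro A B ⟨hA, q, hq⟩ ⟨hB, p, hp⟩
    exact ⟨by simp [hA, hB], q + p, by simp [hq, hp]⟩
  zero_mem' := ⟨by simp, 0, by simp⟩
  neg_mem' := by
    rintro A ⟨hA, q, hq⟩
    exact ⟨by simp [hA], -q, by simp [hq]⟩

/-- The module `M` is `N`-injective: every morphism from a submodule of `N` to `M` extends
to `N`. -/
def IsInjectiveRel (R : Type u) [Ring R] (M : Type v) [AddCommGroup M] [Module R M]
    (N : Type w) [AddCommGroup N] [Module R N] : Prop :=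
  ∀ (K : Submodule R N) (φ : K →ₗ[R] M), ∃ ψ : N →ₗ[R] M, ∀ x : K, ψ x = φ x

/-- The module `M` is `N`-projective: every morphism from `M` to an epimorphic image of `N`
lifts to `N`. -/
def IsProjectiveRel (R : Type u) [Ring R] (M : Type v) [AddCommGroup M] [Module R M]
    (N : Type w) [AddCommGroup N] [Module R N] : Prop :=
  ∀ (K : Type w) [AddCommGroup K] [Module R K] (g : N →ₗ[R] K), Function.Surjective g →
    ∀ ψ : M →ₗ[R] K, ∃ ψ' : M →ₗ[R] N, g ∘ₗ ψ' = ψ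

/-- The class of all left `R`-modules relative to which `M` is injective. -/
def injectivityDomain (R : Type u) [Ring R] (M : ModuleCat.{v} R) : Set (ModuleCat.{v} R) :=
  {N | IsInjectiveRel R M N}

/-- The class of all left `R`-modules relative to which `M` is projective. -/
def projectivityDomain (R : Type u) [Ring R] (M : ModuleCat.{v} R) : Set (ModuleCat.{v} R) :=
  {N | IsProjectiveRel R M N}

/-- The class of semisimple left `R`-modules. -/
def semisimpleModules (R : Type u) [Ring R] : Set (ModuleCat.{v} R) :=
  {N | IsSemisimpleModule R N}

/-- The left injective profile of `R`: all injectivity domains of left `R`-modules. -/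
def leftIProfile (R : Type u) [Ring R] : Set (Set (ModuleCat.{v} R)) :=
  Set.range (injectivityDomain R)

/-- The left projective profile of `R`: all projectivity domains of left `R`-modules. -/
def leftPProfile (R : Type u) [Ring R] : Set (Set (ModuleCat.{v} R)) :=
  Set.range (projectivityDomain R)

/-- The right injective profile of `R`; right `R`-modules are left modules over the opposite
ring. -/
def rightIProfile (R : Type u) [Ring R] : Set (Set (ModuleCat.{v} Rᵐᵒᵖ)) :=
  leftIProfile Rᵐᵒᵖ

/-- The right projective profile of `R`. -/
def rightPProfile (R : Type u) [Ring R] : Set (Set (ModuleCat.{v} Rᵐᵒᵖ)) :=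
  leftPProfile Rᵐᵒᵖ

/-- `R` has no left `i`-middle class: its left injective profile consists of the class of
semisimple modules and the class of all modules, that is, every left module is poor or
injective. -/
def HasNoLeftIMiddleClass (R : Type u) [Ring R] : Prop :=
  leftIProfile.{u, v} R = {semisimpleModules R, Set.univ}

/-- `R` has no right `i`-middle class. -/
def HasNoRightIMiddleClass (R : Type u) [Ring R] : Prop :=
  rightIProfile.{u, v} R = {semisimpleModules Rᵐᵒᵖ, Set.univ}

/-- `R` has no left `p`-middle class: its left projective profile consists of the class of
semisimple modules and the class of all modules, that is, every left module is p-poor or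
projective. -/
def HasNoLeftPMiddleClass (R : Type u) [Ring R] : Prop :=
  leftPProfile.{u, v} R = {semisimpleModules R, Set.univ}

/-- `R` has no right `p`-middle class. -/
def HasNoRightPMiddleClass (R : Type u) [Ring R] : Prop :=
  rightPProfile.{u, v} R = {semisimpleModules Rᵐᵒᵖ, Set.univ}

/-!
A module over a ring of triangular matrices with diagonal fields `E` and `F` is a pair of vector
spaces, its `E`-component and its `F`-component, with a structure map from the first to the second
(multiplication by the off-diagonal generator `t`); module homomorphisms are the pairs of linear
maps that commute with the structure maps. A module is semisimple exactly when its structure map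
vanishes. For left modules over the matrix ring of the theorem, `E = ℚ` and `F = ℝ`; for right
modules, that is, left modules over the opposite ring, `E = ℝ` and `F = ℚ`, and in both cases the
structure map is `ℚ`-linear.

*No middle classes.* Let `N` have an element `x` with `t x ≠ 0`. If `M` is `N`-injective, extending
maps defined on the `F`-component of `N` shows that the structure map of `M` is surjective
(`arrow_surjective_of_isInjectiveRel`). If `M` is `N`-projective, lifting maps to the quotient of
`N` by its `F`-component shows that every functional on the `E`-component of `M` comes from a
homomorphism to `N` (`exists_hom_of_isProjectiveRel`). So the structure map is injective, and it
takes a basis to a linearly independent family. Surjectivity implies injectivity of the module when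
`E ⊆ F`, as on the left side. For projectivity, the linear independence suffices when `E ⊆ F`, and
injectivity of the structure map suffices when `F ⊆ E`, as on the right side. In each case linear
maps on the two components exist since these are vector spaces, and the defect in commuting with
the structure maps can be absorbed by a correction on one component.

*A right `i`-middle class.* On the right side, take `M = (ℝ, ℚ)` with a nonzero functional
`h : ℝ → ℚ` as structure map. It is not semisimple. Its proper submodules lie in the `F`-component,
from which it follows that `M` is `M`-injective (`RowModule.isInjectiveRel_self`). If `M` were
injective, every functional `ℝ → ℚ` would be of the form `h (b ·)`
(`RowModule.exists_forall_eq_of_isInjectiveRel`), which is impossible because the `ℚ`-dual of `ℝ`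
has larger dimension than `ℝ`.
-/

/-! ### Modules over a triangular ring as pairs of vector spaces -/

/-- A presentation of the ring `T` as a ring of triangular matrices with diagonal entries in the
fields `E` and `F`: (non-unital) embeddings `iE`, `iF` of the diagonal entries, and an off-diagonal
element `t` which generates the off-diagonal part as an `F`-`E`-bimodule. -/
structure TriangularPresentation (T : Type*) [Ring T] (E F : Type*) [Field E] [Field F] where
  iE : E →ₙ+* T
  iF : F →ₙ+* T
  t : T
  t_ne_zero : t ≠ 0
  one_add_one : iE 1 + iF 1 = 1
  t_mul : t * iE 1 = t
  mul_t : iF 1 * t = t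
  span : ∀ x : T, ∃ a b c d, x = iE a + iF b * t * iE c + iF d

namespace TriangularPresentation

variable {T E F : Type*} [Ring T] [Field E] [Field F] (P : TriangularPresentation T E F)
  {M N : Type*} [AddCommGroup M] [Module T M] [AddCommGroup N] [Module T N]

@[simp] lemma iE_one_mul (a : E) : P.iE 1 * P.iE a = P.iE a := by rw [← map_mul, one_mul]

@[simp] lemma iF_one_mul (a : F) : P.iF 1 * P.iF a = P.iF a := by rw [← map_mul, one_mul]

@[simp] lemma iF_mul_iE (a : F) (b : E) : P.iF a * P.iE b = 0 := by
  have h : P.iF 1 * P.iE 1 = 0 := by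
    rw [eq_sub_of_add_eq' P.one_add_one, sub_mul, one_mul, iE_one_mul, sub_self]
  rw [← mul_one a, ← one_mul b, map_mul, map_mul, mul_assoc, ← mul_assoc (P.iF 1), h]
  simp

@[simp] lemma iE_mul_iF (a : E) (b : F) : P.iE a * P.iF b = 0 := by
  have h : P.iE 1 * P.iF 1 = 0 := by
    rw [eq_sub_of_add_eq' P.one_add_one, mul_sub, mul_one, iE_one_mul, sub_self]
  rw [← mul_one a, ← one_mul b, map_mul, map_mul, mul_assoc, ← mul_assoc (P.iE 1), h]
  simp

@[simp] lemma t_mul_iF (b : F) : P.t * P.iF b = 0 := by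
  rw [← P.t_mul, mul_assoc, iE_mul_iF, mul_zero]

@[simp] lemma iE_mul_t (a : E) : P.iE a * P.t = 0 := by
  rw [← P.mul_t, ← mul_assoc, iE_mul_iF, zero_mul]

variable (M) in
/-- The `E`-component of a `T`-module, cut out by the idempotent `iE 1`. -/
def src : AddSubgroup M where
  carrier := {m | P.iE 1 • m = m}
  add_mem' {a b} ha hb := by simp_all [smul_add]
  zero_mem' := by simp
  neg_mem' {a} ha := by simp_all

variable (M) in
/-- The `F`-component of a `T`-module, cut out by the idempotent `iF 1`. -/
def tgt : AddSubgroup M where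
  carrier := {m | P.iF 1 • m = m}
  add_mem' {a b} ha hb := by simp_all [smul_add]
  zero_mem' := by simp
  neg_mem' {a} ha := by simp_all

variable {P} in
lemma mem_src {m : M} : m ∈ P.src M ↔ P.iE 1 • m = m := Iff.rfl

variable {P} in
lemma mem_tgt {m : M} : m ∈ P.tgt M ↔ P.iF 1 • m = m := Iff.rfl

instance : Module E (P.src M) where
  smul a m := ⟨P.iE a • (m : M), by rw [mem_src, smul_smul, iE_one_mul]⟩
  one_smul m := Subtype.ext m.2
  mul_smul a b m := Subtype.ext <| by
    change P.iE (a * b) • (m : M) = P.iE a • P.iE b • (m : M)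
    rw [map_mul, mul_smul]
  smul_zero a := Subtype.ext (smul_zero (P.iE a))
  smul_add a m n := Subtype.ext (smul_add (P.iE a) (m : M) (n : M))
  add_smul a b m := Subtype.ext <| by
    change P.iE (a + b) • (m : M) = P.iE a • (m : M) + P.iE b • (m : M)
    rw [map_add, add_smul]
  zero_smul m := Subtype.ext <| by
    change P.iE 0 • (m : M) = 0
    rw [map_zero, zero_smul]

instance : Module F (P.tgt M) where
  smul a m := ⟨P.iF a • (m : M), by rw [mem_tgt, smul_smul, iF_one_mul]⟩
  one_smul m := Subtype.ext m.2
  mul_smul a b m := Subtype.ext <| by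
    change P.iF (a * b) • (m : M) = P.iF a • P.iF b • (m : M)
    rw [map_mul, mul_smul]
  smul_zero a := Subtype.ext (smul_zero (P.iF a))
  smul_add a m n := Subtype.ext (smul_add (P.iF a) (m : M) (n : M))
  add_smul a b m := Subtype.ext <| by
    change P.iF (a + b) • (m : M) = P.iF a • (m : M) + P.iF b • (m : M)
    rw [map_add, add_smul]
  zero_smul m := Subtype.ext <| by
    change P.iF 0 • (m : M) = 0
    rw [map_zero, zero_smul]

@[simp] lemma coe_src_smul (a : E) (m : P.src M) : ((a • m : P.src M) : M) = P.iE a • (m : M) := rfl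

@[simp] lemma coe_tgt_smul (a : F) (m : P.tgt M) : ((a • m : P.tgt M) : M) = P.iF a • (m : M) := rfl

variable (M) in
/-- Multiplication by `t`, the structure map between the two components of a `T`-module. -/
def arrow : P.src M →+ P.tgt M where
  toFun m := ⟨P.t • (m : M), by rw [mem_tgt, smul_smul, P.mul_t]⟩
  map_zero' := Subtype.ext (smul_zero P.t)
  map_add' m n := Subtype.ext (smul_add P.t (m : M) (n : M))

@[simp] lemma coe_arrow (m : P.src M) : (P.arrow M m : M) = P.t • (m : M) := rfl

/-- The projection of a `T`-module to its `E`-component. -/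
def toSrc : M →+ P.src M where
  toFun m := ⟨P.iE 1 • m, by rw [mem_src, smul_smul, iE_one_mul]⟩
  map_zero' := Subtype.ext (smul_zero _)
  map_add' m n := Subtype.ext (smul_add _ m n)

/-- The projection of a `T`-module to its `F`-component. -/
def toTgt : M →+ P.tgt M where
  toFun m := ⟨P.iF 1 • m, by rw [mem_tgt, smul_smul, iF_one_mul]⟩
  map_zero' := Subtype.ext (smul_zero _)
  map_add' m n := Subtype.ext (smul_add _ m n)

@[simp] lemma coe_toSrc (m : M) : (P.toSrc m : M) = P.iE 1 • m := rfl

@[simp] lemma coe_toTgt (m : M) : (P.toTgt m : M) = P.iF 1 • m := rfl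

lemma toSrc_add_toTgt (m : M) : (P.toSrc m : M) + P.toTgt m = m := by
  simp [← add_smul, P.one_add_one]

@[simp] lemma toSrc_src (m : P.src M) : P.toSrc (m : M) = m := Subtype.ext m.2

@[simp] lemma toTgt_tgt (m : P.tgt M) : P.toTgt (m : M) = m := Subtype.ext m.2

@[simp] lemma toSrc_tgt (m : P.tgt M) : P.toSrc (m : M) = 0 := Subtype.ext <| by
  rw [coe_toSrc, ← mem_tgt.1 m.2, smul_smul, iE_mul_iF, zero_smul]; rfl

@[simp] lemma toTgt_src (m : P.src M) : P.toTgt (m : M) = 0 := Subtype.ext <| by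
  rw [coe_toTgt, ← mem_src.1 m.2, smul_smul, iF_mul_iE, zero_smul]; rfl

lemma iF_smul_src (b : F) (m : P.src M) : P.iF b • (m : M) = 0 := by
  rw [← mem_src.1 m.2, smul_smul, iF_mul_iE, zero_smul]

lemma iE_smul_tgt (b : E) (m : P.tgt M) : P.iE b • (m : M) = 0 := by
  rw [← mem_tgt.1 m.2, smul_smul, iE_mul_iF, zero_smul]

lemma t_smul_tgt (m : P.tgt M) : P.t • (m : M) = 0 := by
  rw [← mem_tgt.1 m.2, smul_smul, t_mul_iF, zero_smul]

/-- The map induced by a `T`-linear map on the `E`-components. -/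
def srcMap (φ : M →ₗ[T] N) : P.src M →ₗ[E] P.src N where
  toFun m := ⟨φ m, by rw [mem_src, ← map_smul, mem_src.1 m.2]⟩
  map_add' m n := Subtype.ext (map_add φ (m : M) n)
  map_smul' a m := Subtype.ext (map_smul φ (P.iE a) (m : M))

/-- The map induced by a `T`-linear map on the `F`-components. -/
def tgtMap (φ : M →ₗ[T] N) : P.tgt M →ₗ[F] P.tgt N where
  toFun m := ⟨φ m, by rw [mem_tgt, ← map_smul, mem_tgt.1 m.2]⟩
  map_add' m n := Subtype.ext (map_add φ (m : M) n)
  map_smul' a m := Subtype.ext (map_smul φ (P.iF a) (m : M))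

@[simp] lemma coe_srcMap (φ : M →ₗ[T] N) (m : P.src M) : (P.srcMap φ m : N) = φ m := rfl

@[simp] lemma coe_tgtMap (φ : M →ₗ[T] N) (m : P.tgt M) : (P.tgtMap φ m : N) = φ m := rfl

lemma tgtMap_arrow (φ : M →ₗ[T] N) (m : P.src M) :
    P.tgtMap φ (P.arrow M m) = P.arrow N (P.srcMap φ m) :=
  Subtype.ext (map_smul φ P.t (m : M))

lemma srcMap_injective {φ : M →ₗ[T] N} (h : Function.Injective φ) :
    Function.Injective (P.srcMap φ) :=
  fun _ _ hab => Subtype.ext (h (congrArg Subtype.val hab))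

lemma tgtMap_injective {φ : M →ₗ[T] N} (h : Function.Injective φ) :
    Function.Injective (P.tgtMap φ) :=
  fun _ _ hab => Subtype.ext (h (congrArg Subtype.val hab))

lemma srcMap_surjective {φ : M →ₗ[T] N} (h : Function.Surjective φ) :
    Function.Surjective (P.srcMap φ) := fun n => by
  obtain ⟨m, hm⟩ := h n
  exact ⟨P.toSrc m, Subtype.ext (by simp [hm, mem_src.1 n.2])⟩

lemma tgtMap_surjective {φ : M →ₗ[T] N} (h : Function.Surjective φ) :
    Function.Surjective (P.tgtMap φ) := fun n => by
  obtain ⟨m, hm⟩ := h n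
  exact ⟨P.toTgt m, Subtype.ext (by simp [hm, mem_tgt.1 n.2])⟩

lemma linearMap_ext {φ ψ : M →ₗ[T] N} (h₁ : ∀ m : P.src M, φ m = ψ m)
    (h₂ : ∀ m : P.tgt M, φ m = ψ m) : φ = ψ := by
  ext m
  rw [← P.toSrc_add_toTgt m, map_add, map_add, h₁, h₂]

/-- Linear maps between the components which commute with the structure maps assemble to a
`T`-linear map. -/
def hom (u : P.src M →ₗ[E] P.src N) (v : P.tgt M →ₗ[F] P.tgt N)
    (h : ∀ m, v (P.arrow M m) = P.arrow N (u m)) : M →ₗ[T] N where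
  toFun m := u (P.toSrc m) + v (P.toTgt m)
  map_add' m n := by simp only [map_add, AddSubgroup.coe_add]; abel
  map_smul' x m := by
    have hE (a : E) (m : M) : (u (P.toSrc (P.iE a • m)) + v (P.toTgt (P.iE a • m)) : N) =
        P.iE a • (u (P.toSrc m) + v (P.toTgt m) : N) := by
      have h₁ : P.toSrc (P.iE a • m) = a • P.toSrc m := Subtype.ext <| by
        simp [smul_smul, ← map_mul]
      have h₂ : P.toTgt (P.iE a • m) = 0 := Subtype.ext <| by simp [smul_smul]
      simp [h₁, h₂, smul_add, iE_smul_tgt]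
    have hF (a : F) (m : M) : (u (P.toSrc (P.iF a • m)) + v (P.toTgt (P.iF a • m)) : N) =
        P.iF a • (u (P.toSrc m) + v (P.toTgt m) : N) := by
      have h₁ : P.toTgt (P.iF a • m) = a • P.toTgt m := Subtype.ext <| by
        simp [smul_smul, ← map_mul]
      have h₂ : P.toSrc (P.iF a • m) = 0 := Subtype.ext <| by simp [smul_smul]
      simp [h₁, h₂, smul_add, iF_smul_src]
    have ht (m : M) : (u (P.toSrc (P.t • m)) + v (P.toTgt (P.t • m)) : N) =
        P.t • (u (P.toSrc m) + v (P.toTgt m) : N) := by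
      have h₁ : P.toTgt (P.t • m) = P.arrow M (P.toSrc m) := Subtype.ext <| by
        simp [smul_smul, P.mul_t, P.t_mul]
      have h₂ : P.toSrc (P.t • m) = 0 := Subtype.ext <| by simp [smul_smul]
      simp [h₁, h₂, smul_add, t_smul_tgt, h]
    obtain ⟨a, b, c, d, rfl⟩ := P.span x
    simp only [add_smul, mul_smul, map_add, AddSubgroup.coe_add, RingHom.id_apply, ← hE, ← hF, ← ht]
    abel

@[simp] lemma hom_src (u : P.src M →ₗ[E] P.src N) (v : P.tgt M →ₗ[F] P.tgt N)
    (h : ∀ m, v (P.arrow M m) = P.arrow N (u m)) (m : P.src M) : P.hom u v h m = u m := by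
  simp [hom]

@[simp] lemma hom_tgt (u : P.src M →ₗ[E] P.src N) (v : P.tgt M →ₗ[F] P.tgt N)
    (h : ∀ m, v (P.arrow M m) = P.arrow N (u m)) (m : P.tgt M) : P.hom u v h m = v m := by
  simp [hom]

variable (N) in
/-- The `F`-component, as a `T`-submodule. -/
def tgtSubmodule : Submodule T N where
  carrier := {m | P.iE 1 • m = 0}
  add_mem' {a b} ha hb := by simp_all [smul_add]
  zero_mem' := by simp
  smul_mem' x m hm := by
    have hE (a : E) : P.iE a • m = 0 := by
      rw [← mul_one a, map_mul, mul_smul, show P.iE 1 • m = 0 from hm, smul_zero]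
    obtain ⟨a, b, c, d, rfl⟩ := P.span x
    change P.iE 1 • _ = 0
    simp [add_smul, mul_smul, hE, smul_smul]

variable {P} in
lemma mem_tgtSubmodule {m : N} : m ∈ P.tgtSubmodule N ↔ P.iE 1 • m = 0 := Iff.rfl

lemma tgt_mem_tgtSubmodule (m : P.tgt N) : (m : N) ∈ P.tgtSubmodule N := P.iE_smul_tgt 1 m

lemma eq_zero_of_src_tgtSubmodule (m : P.src (P.tgtSubmodule N)) : m = 0 :=
  Subtype.ext (Subtype.ext ((congrArg Subtype.val (mem_src.1 m.2)).symm.trans m.1.2))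

/-! ### Semisimple modules -/

lemma isSemisimpleModule_of_arrow (h : ∀ m, P.arrow N m = 0) : IsSemisimpleModule T N := by
  refine (isSemisimpleModule_iff T N).2 ⟨fun K => ?_⟩
  obtain ⟨u, hu⟩ := (P.srcMap K.subtype).exists_leftInverse_of_injective
    (LinearMap.ker_eq_bot.2 (P.srcMap_injective K.injective_subtype))
  obtain ⟨v, hv⟩ := (P.tgtMap K.subtype).exists_leftInverse_of_injective
    (LinearMap.ker_eq_bot.2 (P.tgtMap_injective K.injective_subtype))
  have hK (k : P.src K) : P.arrow K k = 0 :=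
    P.tgtMap_injective K.injective_subtype (by rw [tgtMap_arrow, h, map_zero])
  have huv (m : P.src N) : v (P.arrow N m) = P.arrow K (u m) := by rw [h, hK, map_zero]
  have hp : P.hom u v huv ∘ₗ K.subtype = LinearMap.id :=
    P.linearMap_ext
      (fun m => (P.hom_src u v huv (P.srcMap K.subtype m)).trans
        (congrArg _ (LinearMap.congr_fun hu m)))
      (fun m => (P.hom_tgt u v huv (P.tgtMap K.subtype m)).trans
        (congrArg _ (LinearMap.congr_fun hv m)))
  exact ⟨_, LinearMap.isCompl_of_proj (f := P.hom u v huv) (LinearMap.congr_fun hp)⟩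

lemma arrow_eq_zero_of_isSemisimpleModule [IsSemisimpleModule T N] (m : P.src N) :
    P.arrow N m = 0 := by
  -- A retraction `p` onto the `F`-component kills `m`, so it also kills `t • m`, which it fixes.
  obtain ⟨p, hp⟩ := IsSemisimpleModule.extension_property (P.tgtSubmodule N).subtype
    (P.tgtSubmodule N).injective_subtype LinearMap.id
  have h₀ : p m = 0 := congrArg Subtype.val (P.eq_zero_of_src_tgtSubmodule (P.srcMap p m))
  have h : p (P.t • (m : N)) = ⟨_, P.tgt_mem_tgtSubmodule (P.arrow N m)⟩ :=
    LinearMap.congr_fun hp ⟨_, P.tgt_mem_tgtSubmodule (P.arrow N m)⟩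
  rw [map_smul, h₀, smul_zero] at h
  exact Subtype.ext (congrArg Subtype.val h).symm

end TriangularPresentation

lemma isInjectiveRel_of_isSemisimpleModule {T M N : Type*} [Ring T] [AddCommGroup M] [Module T M]
    [AddCommGroup N] [Module T N] [IsSemisimpleModule T N] : IsInjectiveRel T M N := by
  intro K φ
  obtain ⟨ψ, hψ⟩ := IsSemisimpleModule.extension_property K.subtype K.injective_subtype φ
  exact ⟨ψ, LinearMap.congr_fun hψ⟩

lemma isProjectiveRel_of_isSemisimpleModule {T M N : Type*} [Ring T] [AddCommGroup M] [Module T M]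
    [AddCommGroup N] [Module T N] [IsSemisimpleModule T N] : IsProjectiveRel T M N :=
  fun _ _ _ g hg ψ => IsSemisimpleModule.lifting_property g hg ψ

namespace TriangularPresentation

variable {T E F : Type*} [Ring T] [Field E] [Field F] (P : TriangularPresentation T E F)
  {M N : Type*} [AddCommGroup M] [Module T M] [AddCommGroup N] [Module T N]

/-! ### Relative injectivity -/

lemma arrow_smul {σ : E →+* F} (hσ : ∀ a, P.t * P.iE a = P.iF (σ a) * P.t) (a : E) (m : P.src M) :
    P.arrow M (a • m) = σ a • P.arrow M m := Subtype.ext <| by simp [smul_smul, hσ]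

lemma arrow_map_smul {σ : F →+* E} (hσ : ∀ a, P.iF a * P.t = P.t * P.iE (σ a)) (a : F)
    (m : P.src M) : P.arrow M (σ a • m) = a • P.arrow M m := Subtype.ext <| by simp [smul_smul, hσ]

/-- A nonzero value `t • x` in `N` can be mapped to any element of the `F`-component of `M`; an
extension of such a map to `N` shows that this element is in the range of the structure map. -/
lemma arrow_surjective_of_isInjectiveRel (h : IsInjectiveRel T M N) {x : P.src N}
    (hx : P.arrow N x ≠ 0) : Function.Surjective (P.arrow M) := by
  intro y
  obtain ⟨f, hf⟩ := Module.Projective.exists_dual_eq_one F hx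
  let W := P.tgtSubmodule N
  obtain ⟨ψ, hψ⟩ := h W <| P.hom 0 (f.smulRight y ∘ₗ P.tgtMap W.subtype) fun m => by
    rw [P.eq_zero_of_src_tgtSubmodule m]; simp
  have hz : (⟨P.arrow N x, P.tgt_mem_tgtSubmodule _⟩ : W) ∈ P.tgt W :=
    Subtype.ext (mem_tgt.1 (P.arrow N x).2)
  refine ⟨P.srcMap ψ x, ?_⟩
  rw [← tgtMap_arrow]
  refine Subtype.ext ((hψ ⟨_, P.tgt_mem_tgtSubmodule (P.arrow N x)⟩).trans ?_)
  refine (P.hom_tgt _ _ _ ⟨_, hz⟩).trans ?_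
  change ((f (P.arrow N x) • y : P.tgt M) : M) = y
  rw [hf, one_smul]

/-- If `E` acts on the off-diagonal part through a map to `F`, the structure map of `M` is
semilinear, so it has a semilinear section once it is surjective. Extensions of the two components
of a map to `M` are then made compatible by correcting the one on the `E`-components. -/
lemma isInjectiveRel_of_arrow_surjective (σ : E →+* F) (hσ : ∀ a, P.t * P.iE a = P.iF (σ a) * P.t)
    (h : Function.Surjective (P.arrow M)) : IsInjectiveRel T M N := by
  obtain ⟨s, hs, hαs⟩ : ∃ s : P.tgt M →+ P.src M, (∀ (a : E) y, s (σ a • y) = a • s y) ∧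
      ∀ y, P.arrow M (s y) = y := by
    let _ : Module E (P.tgt M) := Module.compHom _ σ
    let α : P.src M →ₗ[E] P.tgt M := { P.arrow M with map_smul' := P.arrow_smul hσ }
    obtain ⟨s, hs⟩ := Module.projective_lifting_property α LinearMap.id h
    exact ⟨s.toAddMonoidHom, s.map_smul, LinearMap.congr_fun hs⟩
  intro K φ
  obtain ⟨u, hu⟩ := IsSemisimpleModule.extension_property _
    (P.srcMap_injective K.injective_subtype) (P.srcMap φ)
  obtain ⟨v, hv⟩ := IsSemisimpleModule.extension_property _
    (P.tgtMap_injective K.injective_subtype) (P.tgtMap φ)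
  replace hu (k : P.src K) : u (P.srcMap K.subtype k) = P.srcMap φ k := LinearMap.congr_fun hu k
  replace hv (k : P.tgt K) : v (P.tgtMap K.subtype k) = P.tgtMap φ k := LinearMap.congr_fun hv k
  let w : P.src N →ₗ[E] P.src M :=
    { toFun := fun m => u m + s (v (P.arrow N m) - P.arrow M (u m))
      map_add' := fun m n => by simp only [map_add, map_sub]; abel
      map_smul' := fun a m => by
        simp only [map_smul, P.arrow_smul hσ, ← smul_sub, hs, ← smul_add, RingHom.id_apply] }
  have hw (m : P.src N) : v (P.arrow N m) = P.arrow M (w m) := by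
    change _ = P.arrow M (u m + s (v (P.arrow N m) - P.arrow M (u m)))
    rw [map_add, hαs, add_sub_cancel]
  refine ⟨P.hom w v hw, LinearMap.congr_fun (f := P.hom w v hw ∘ₗ K.subtype) (g := φ)
    (P.linearMap_ext (fun k => (P.hom_src w v hw (P.srcMap K.subtype k)).trans ?_)
      (fun k => (P.hom_tgt w v hw (P.tgtMap K.subtype k)).trans (congrArg _ (hv k))))⟩
  change ((u _ + s (v (P.arrow N _) - P.arrow M (u _)) : P.src M) : M) = φ k
  rw [hu, ← tgtMap_arrow, hv, tgtMap_arrow, sub_self, map_zero, add_zero, coe_srcMap]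

/-- A module with one-dimensional components and surjective structure map is quasi-injective if `F`
acts on the off-diagonal part through a map to `E`, so that `F` acts by `T`-linear maps. -/
lemma isInjectiveRel_self (σ : F →+* E) (hσ : ∀ a, P.iF a * P.t = P.t * P.iE (σ a))
    (hM : Function.Surjective (P.arrow M)) (x : P.src M) (hx : ∀ m : P.src M, ∃ a : E, a • x = m)
    (y : P.tgt M) (hy : ∀ m : P.tgt M, ∃ b : F, b • y = m) : IsInjectiveRel T M M := by
  intro K φ
  by_cases hK : ∀ k : P.src K, k = 0
  · -- `K` is contained in the `F`-component, where `φ` is multiplication by a scalar.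
    obtain ⟨v, hv⟩ := IsSemisimpleModule.extension_property _
      (P.tgtMap_injective K.injective_subtype) (P.tgtMap φ)
    obtain ⟨b, hb⟩ := hy (v y)
    have hvb (m : P.tgt M) : v m = b • m := by
      obtain ⟨c, rfl⟩ := hy m
      rw [map_smul, ← hb, smul_comm]
    have hw (m : P.src M) : v (P.arrow M m) = P.arrow M (LinearMap.lsmul E _ (σ b) m) := by
      rw [hvb]
      exact Subtype.ext (by simp [smul_smul, hσ])
    refine ⟨P.hom (LinearMap.lsmul E _ (σ b)) v hw,
      LinearMap.congr_fun (f := P.hom _ v hw ∘ₗ K.subtype) (g := φ)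
      (P.linearMap_ext (fun k => by rw [hK k]; simp)
        (fun k => (P.hom_tgt _ v hw (P.tgtMap K.subtype k)).trans
          (congrArg _ (LinearMap.congr_fun hv k))))⟩
  · -- `K` contains a generator of `M`.
    push Not at hK
    obtain ⟨k, hk⟩ := hK
    have hxK : (x : M) ∈ K := by
      obtain ⟨a, ha⟩ := hx (P.srcMap K.subtype k)
      have ha₀ : a ≠ 0 := by
        rintro rfl
        exact hk (P.srcMap_injective K.injective_subtype (by rw [← ha, zero_smul, map_zero]))
      rw [← inv_smul_smul₀ ha₀ x, ha]
      exact K.smul_mem _ k.1.2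
    have hsrc (m : P.src M) : (m : M) ∈ K := by
      obtain ⟨a, rfl⟩ := hx m
      exact K.smul_mem _ hxK
    have hKtop (m : M) : m ∈ K := by
      rw [← P.toSrc_add_toTgt m]
      obtain ⟨z, hz⟩ := hM (P.toTgt m)
      exact K.add_mem (hsrc _) (hz ▸ K.smul_mem P.t (hsrc z))
    exact ⟨φ ∘ₗ LinearMap.id.codRestrict K hKtop, fun m => rfl⟩

/-! ### Relative projectivity -/

/-- If `M` is `N`-projective, any functional on the `E`-component of `M` is the coordinate along `x`
of a map to `N`: lift the map to the quotient of `N` by its `F`-component. -/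
lemma exists_hom_of_isProjectiveRel (h : IsProjectiveRel T M N) (x : P.src N)
    (f : P.src M →ₗ[E] E) : ∃ ψ : M →ₗ[T] N, ∀ m, P.srcMap ψ m = f m • x := by
  let W := P.tgtSubmodule N
  have hW (m : P.src M) : (0 : P.tgt (N ⧸ W)) =
      P.arrow (N ⧸ W) ((P.srcMap W.mkQ ∘ₗ f.smulRight x) m) := by
    refine Subtype.ext (((Submodule.Quotient.mk_eq_zero W).2 ?_).symm)
    exact P.tgt_mem_tgtSubmodule (P.arrow N (f m • x))
  obtain ⟨ψ, hψ⟩ := h (N ⧸ W) W.mkQ W.mkQ_surjective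
    (P.hom (P.srcMap W.mkQ ∘ₗ f.smulRight x) 0 hW)
  refine ⟨ψ, fun m => ?_⟩
  have h₁ : W.mkQ (ψ m) = W.mkQ (f m • x : P.src N) :=
    (LinearMap.congr_fun hψ (m : M)).trans (P.hom_src _ _ hW m)
  have h₂ : P.iE 1 • (ψ m - (f m • x : P.src N)) = 0 := (Submodule.Quotient.eq W).1 h₁
  rw [smul_sub, sub_eq_zero, mem_src.1 (f m • x).2] at h₂
  exact Subtype.ext ((mem_src.1 (P.srcMap ψ m).2).symm.trans h₂)

lemma arrow_injective_of_isProjectiveRel (h : IsProjectiveRel T M N) {x : P.src N}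
    (hx : P.arrow N x ≠ 0) : Function.Injective (P.arrow M) := by
  refine (injective_iff_map_eq_zero _).2 fun m hm => by_contra fun hm₀ => hx ?_
  obtain ⟨f, hf⟩ := Module.Projective.exists_dual_eq_one E hm₀
  obtain ⟨ψ, hψ⟩ := P.exists_hom_of_isProjectiveRel h x f
  rw [← one_smul E x, ← hf, ← hψ, ← tgtMap_arrow, hm, map_zero]

/-- The structure map sends a basis to a linearly independent family, that is, its `F`-linear
extension to the scalar extension of the `E`-component is injective. Applying the lifts of the
coordinate functionals to a linear relation isolates its coefficients. -/
lemma linearIndependent_of_isProjectiveRel (h : IsProjectiveRel T M N) {x : P.src N}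
    (hx : P.arrow N x ≠ 0) {ι : Type*} (b : Module.Basis ι E (P.src M)) :
    LinearIndependent F (P.arrow M ∘ b) := by
  classical
  rw [linearIndependent_iff]
  intro l hl
  ext j
  obtain ⟨ψ, hψ⟩ := P.exists_hom_of_isProjectiveRel h x (b.coord j)
  have h₁ : l j • P.arrow N x = P.tgtMap ψ (Finsupp.linearCombination F (P.arrow M ∘ b) l) := by
    rw [Finsupp.apply_linearCombination, Finsupp.linearCombination_apply, Finsupp.sum,
      Finset.sum_eq_single j]
    · simp [tgtMap_arrow, hψ]
    · intro i _ hi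
      simp [tgtMap_arrow, hψ, Finsupp.single_eq_of_ne, hi.symm]
    · intro hj
      rw [Finsupp.notMem_support_iff.1 hj, zero_smul]
  rw [hl, map_zero] at h₁
  simpa using (smul_eq_zero.1 h₁).resolve_right hx

/-- Lifts of the two components of a map from `M` can be made compatible as soon as the failure to
commute with the structure maps extends from the range of the structure map of `M`. -/
lemma isProjectiveRel_of_exists_extension
    (h : ∀ (u : P.src M →ₗ[E] P.src N) (v : P.tgt M →ₗ[F] P.tgt N) (V : Submodule F (P.tgt N)),
      (∀ m, P.arrow N (u m) - v (P.arrow M m) ∈ V) →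
      ∃ w : P.tgt M →ₗ[F] V, ∀ m, (w (P.arrow M m) : P.tgt N) =
        P.arrow N (u m) - v (P.arrow M m)) : IsProjectiveRel T M N := by
  intro K _ _ g hg ψ
  obtain ⟨u, hu⟩ := Module.projective_lifting_property _ (P.srcMap ψ) (P.srcMap_surjective hg)
  obtain ⟨v, hv⟩ := Module.projective_lifting_property _ (P.tgtMap ψ) (P.tgtMap_surjective hg)
  replace hu (m : P.src M) : P.srcMap g (u m) = P.srcMap ψ m := LinearMap.congr_fun hu m
  replace hv (m : P.tgt M) : P.tgtMap g (v m) = P.tgtMap ψ m := LinearMap.congr_fun hv m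
  obtain ⟨w, hw⟩ := h u v (LinearMap.ker (P.tgtMap g)) fun m => by
    rw [LinearMap.mem_ker, map_sub, tgtMap_arrow, hu, hv, tgtMap_arrow, sub_self]
  have hvw (m : P.src M) :
      (v + Submodule.subtype _ ∘ₗ w) (P.arrow M m) = P.arrow N (u m) := by
    simp [hw]
  refine ⟨P.hom u _ hvw, P.linearMap_ext (fun m => ?_) (fun m => ?_)⟩
  · rw [LinearMap.comp_apply, hom_src]
    exact congrArg Subtype.val (hu m)
  · rw [LinearMap.comp_apply, hom_tgt]
    refine congrArg Subtype.val (?_ : P.tgtMap g (v m + w m) = P.tgtMap ψ m)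
    rw [map_add, hv, (w m).2, add_zero]

lemma isProjectiveRel_of_arrow_injective (σ : F →+* E)
    (hσ : ∀ a, P.iF a * P.t = P.t * P.iE (σ a)) (h : Function.Injective (P.arrow M)) :
    IsProjectiveRel T M N := by
  refine P.isProjectiveRel_of_exists_extension fun u v V hV => ?_
  let _ : Module F (P.src M) := Module.compHom _ σ
  let α : P.src M →ₗ[F] P.tgt M := { P.arrow M with map_smul' := P.arrow_map_smul hσ }
  let d : P.src M →ₗ[F] V :=
    { toFun := fun m => ⟨_, hV m⟩
      map_add' := fun m n => Subtype.ext <| by simp only [map_add, Submodule.coe_add]; abel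
      map_smul' := fun a m => Subtype.ext <| by
        change P.arrow N (u (σ a • m)) - v (P.arrow M (σ a • m)) =
          a • (P.arrow N (u m) - v (P.arrow M m))
        rw [map_smul, P.arrow_map_smul hσ, P.arrow_map_smul hσ, map_smul, smul_sub] }
  obtain ⟨w, hw⟩ := IsSemisimpleModule.extension_property α h d
  exact ⟨w, fun m => congrArg Subtype.val (LinearMap.congr_fun hw m)⟩

lemma isProjectiveRel_of_linearIndependent (σ : E →+* F)
    (hσ : ∀ a, P.t * P.iE a = P.iF (σ a) * P.t) {ι : Type*} (b : Module.Basis ι E (P.src M))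
    (hb : LinearIndependent F (P.arrow M ∘ b)) : IsProjectiveRel T M N := by
  refine P.isProjectiveRel_of_exists_extension fun u v V hV => ?_
  obtain ⟨w, hw⟩ := IsSemisimpleModule.extension_property _ hb
    (Finsupp.linearCombination F fun i => (⟨_, hV (b i)⟩ : V))
  refine ⟨w, fun m => ?_⟩
  induction b.mem_span m using Submodule.span_induction with
  | mem m hm =>
    obtain ⟨i, rfl⟩ := hm
    simpa using congrArg Subtype.val (LinearMap.congr_fun hw (Finsupp.single i 1))
  | zero => simp
  | add m n _ _ hm hn => simp only [map_add, Submodule.coe_add, hm, hn]; abel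
  | smul a m _ hm => simp only [P.arrow_smul hσ, map_smul, Submodule.coe_smul, hm, smul_sub]

end TriangularPresentation

/-! ### Profiles -/

lemma range_eq_pair_univ {α β : Type*} {D : α → Set β} {S : Set β} (hS : ∀ M, S ⊆ D M)
    (hD : ∀ M, ∀ N ∈ D M, N ∉ S → D M = Set.univ) (h₁ : ∃ M, D M = Set.univ)
    (h₂ : ∃ M, D M ≠ Set.univ) : Set.range D = {S, Set.univ} := by
  have hD' (M) : D M = S ∨ D M = Set.univ := by
    by_cases h : D M ⊆ S
    · exact .inl (h.antisymm (hS M))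
    · obtain ⟨N, hN, hNS⟩ := Set.not_subset.1 h
      exact .inr (hD M N hN hNS)
  refine Set.Subset.antisymm (by rintro _ ⟨M, rfl⟩; exact hD' M) ?_
  rintro _ (rfl | rfl)
  · obtain ⟨M, hM⟩ := h₂
    exact ⟨M, (hD' M).resolve_right hM⟩
  · exact h₁

namespace TriangularPresentation

variable {T : Type} {E F : Type*} [Ring T] [Field E] [Field F] (P : TriangularPresentation T E F)

lemma exists_arrow_ne_zero {N : ModuleCat.{v} T} (h : N ∉ semisimpleModules T) :
    ∃ x : P.src N, P.arrow N x ≠ 0 := by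
  by_contra! h'
  exact h (P.isSemisimpleModule_of_arrow h')

lemma exists_arrow_ulift_ne_zero : ∃ x : P.src (ULift.{v} T), P.arrow (ULift.{v} T) x ≠ 0 :=
  ⟨⟨⟨P.iE 1⟩, ULift.ext _ _ (P.iE_one_mul 1)⟩, fun h =>
    P.t_ne_zero (P.t_mul.symm.trans (congrArg (fun x => x.1.down) h))⟩

include P in
lemma not_isSemisimpleRing : ¬ IsSemisimpleRing T := fun h => by
  obtain ⟨x, hx⟩ := P.exists_arrow_ulift_ne_zero (T := T)
  have : IsSemisimpleModule T (ULift.{0} T) := .congr ULift.moduleEquiv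
  exact hx (P.arrow_eq_zero_of_isSemisimpleModule x)

lemma exists_src_nontrivial_arrow_eq_zero : ∃ M : ModuleCat.{v} T,
    Nontrivial (P.src M) ∧ ∀ x, P.arrow M x = 0 := by
  let W := P.tgtSubmodule (ULift.{v} T)
  refine ⟨ModuleCat.of T (ULift.{v} T ⧸ W), ⟨⟨W.mkQ ⟨P.iE 1⟩, ?_⟩, 0, fun h => ?_⟩, fun x => ?_⟩
  · exact congrArg W.mkQ (ULift.ext _ _ (P.iE_one_mul 1) : P.iE 1 • ULift.up (P.iE 1) = _)
  · have h₁ : P.iE 1 • (⟨P.iE 1⟩ : ULift.{v} T) = 0 :=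
      (Submodule.Quotient.mk_eq_zero W).1 (congrArg Subtype.val h)
    have h₂ : P.iE 1 = 0 := (P.iE_one_mul 1).symm.trans (congrArg ULift.down h₁)
    exact P.t_ne_zero (by rw [← P.t_mul, h₂, mul_zero])
  · obtain ⟨z, hz⟩ := W.mkQ_surjective (x : ULift.{v} T ⧸ W)
    refine Subtype.ext ?_
    rw [coe_arrow, ← hz, ← map_smul]
    refine (Submodule.Quotient.mk_eq_zero W).2 ?_
    rw [mem_tgtSubmodule, smul_smul, iE_mul_t, zero_smul]

lemma exists_arrow_not_surjective :
    ∃ M : ModuleCat.{v} T, ¬ Function.Surjective (P.arrow M) := by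
  let W := P.tgtSubmodule (ULift.{v} T)
  obtain ⟨x, hx⟩ := P.exists_arrow_ulift_ne_zero (T := T)
  have hy : (⟨P.arrow _ x, P.tgt_mem_tgtSubmodule _⟩ : W) ∈ P.tgt W :=
    Subtype.ext (mem_tgt.1 (P.arrow _ x).2)
  refine ⟨ModuleCat.of T W, fun h => hx ?_⟩
  obtain ⟨z, hz⟩ := h ⟨_, hy⟩
  rw [show z = 0 from P.eq_zero_of_src_tgtSubmodule z, map_zero] at hz
  exact Subtype.ext (congrArg (fun y => y.1.1) hz).symm

theorem leftIProfile_eq (σ : E →+* F) (hσ : ∀ a, P.t * P.iE a = P.iF (σ a) * P.t) :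
    leftIProfile.{0, v} T = {semisimpleModules T, Set.univ} := by
  refine range_eq_pair_univ (fun M N (hN : IsSemisimpleModule T N) =>
    isInjectiveRel_of_isSemisimpleModule) (fun M N hN hNS => ?_) ?_ ?_
  · obtain ⟨x, hx⟩ := P.exists_arrow_ne_zero hNS
    exact Set.eq_univ_of_forall fun L => P.isInjectiveRel_of_arrow_surjective σ hσ
      (P.arrow_surjective_of_isInjectiveRel hN hx)
  · exact ⟨ModuleCat.of T PUnit, Set.eq_univ_of_forall fun L K φ => ⟨0, fun _ => rfl⟩⟩
  · obtain ⟨M, hM⟩ := P.exists_arrow_not_surjective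
    obtain ⟨x, hx⟩ := P.exists_arrow_ulift_ne_zero (T := T)
    refine ⟨M, fun h => hM (P.arrow_surjective_of_isInjectiveRel ?_ hx)⟩
    exact h.ge (Set.mem_univ (ModuleCat.of T (ULift.{v} T)))

/-- A module that is projective relative to one module with nonzero structure map has injective
structure map, so not every module is projective. The other half, that it is projective relative to
every module, depends on the bimodule structure of the off-diagonal part. -/
lemma leftPProfile_eq (h : ∀ M N L : ModuleCat.{v} T, IsProjectiveRel T M N →
      (∃ x, P.arrow N x ≠ 0) → IsProjectiveRel T M L) :
    leftPProfile.{0, v} T = {semisimpleModules T, Set.univ} := by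
  refine range_eq_pair_univ (fun M N (hN : IsSemisimpleModule T N) =>
    isProjectiveRel_of_isSemisimpleModule) (fun M N hN hNS => ?_) ?_ ?_
  · exact Set.eq_univ_of_forall fun L => h M N L hN (P.exists_arrow_ne_zero hNS)
  · exact ⟨ModuleCat.of T PUnit, Set.eq_univ_of_forall fun L K _ _ g _ ψ =>
      ⟨0, LinearMap.ext fun x => by simp [Subsingleton.elim x 0]⟩⟩
  · obtain ⟨M, hM, hM₀⟩ := P.exists_src_nontrivial_arrow_eq_zero
    obtain ⟨x, hx⟩ := P.exists_arrow_ulift_ne_zero (T := T)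
    obtain ⟨m, hm⟩ := exists_ne (0 : P.src M)
    refine ⟨M, fun h => hm (P.arrow_injective_of_isProjectiveRel ?_ hx (by rw [hM₀, map_zero]))⟩
    exact h.ge (Set.mem_univ (ModuleCat.of T (ULift.{v} T)))

theorem leftPProfile_eq_of_map_src (σ : E →+* F) (hσ : ∀ a, P.t * P.iE a = P.iF (σ a) * P.t) :
    leftPProfile.{0, v} T = {semisimpleModules T, Set.univ} :=
  P.leftPProfile_eq fun M _ _ hN ⟨_, hx⟩ => P.isProjectiveRel_of_linearIndependent σ hσ
    (Module.Basis.ofVectorSpace E (P.src M)) (P.linearIndependent_of_isProjectiveRel hN hx _)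

theorem leftPProfile_eq_of_map_tgt (σ : F →+* E) (hσ : ∀ a, P.iF a * P.t = P.t * P.iE (σ a)) :
    leftPProfile.{0, v} T = {semisimpleModules T, Set.univ} :=
  P.leftPProfile_eq fun _ _ _ hN ⟨_, hx⟩ => P.isProjectiveRel_of_arrow_injective σ hσ
    (P.arrow_injective_of_isProjectiveRel hN hx)

open MulOpposite in
/-- Passing to the opposite ring interchanges the roles of the two fields. -/
def op : TriangularPresentation Tᵐᵒᵖ F E where
  iE :=
    { toFun := fun a => MulOpposite.op (P.iF a)
      map_mul' := fun a b => by rw [mul_comm, map_mul, op_mul]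
      map_zero' := by rw [map_zero, op_zero]
      map_add' := fun a b => by rw [map_add, op_add] }
  iF :=
    { toFun := fun a => MulOpposite.op (P.iE a)
      map_mul' := fun a b => by rw [mul_comm, map_mul, op_mul]
      map_zero' := by rw [map_zero, op_zero]
      map_add' := fun a b => by rw [map_add, op_add] }
  t := MulOpposite.op P.t
  t_ne_zero := by simpa using P.t_ne_zero
  one_add_one := by
    change MulOpposite.op (P.iF 1) + MulOpposite.op (P.iE 1) = 1
    rw [← op_add, add_comm, P.one_add_one, op_one]
  t_mul := congrArg MulOpposite.op P.mul_t
  mul_t := congrArg MulOpposite.op P.t_mul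
  span x := by
    obtain ⟨a, b, c, d, h⟩ := P.span x.unop
    refine ⟨d, c, b, a, unop_injective ?_⟩
    rw [h, add_comm, add_comm (P.iE a), ← add_assoc, mul_assoc]
    rfl

end TriangularPresentation

/-! ### The ring of lower triangular matrices -/

namespace lowerTriRing

/-- The matrix `[[q, 0], [r, s]]`. -/
def mk (q : ℚ) (r s : ℝ) : lowerTriRing := ⟨!![(q : ℝ), 0; r, s], by simp, q, by simp⟩

lemma mk_mul (q q' : ℚ) (r r' s s' : ℝ) :
    mk q r s * mk q' r' s' = mk (q * q') (r * q' + s * r') (s * s') :=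
  Subtype.ext <| by simp [mk]

lemma mk_add (q q' : ℚ) (r r' s s' : ℝ) :
    mk q r s + mk q' r' s' = mk (q + q') (r + r') (s + s') :=
  Subtype.ext <| by simp [mk]

lemma mk_zero : mk 0 0 0 = 0 := Subtype.ext <| by
  ext i j; fin_cases i <;> fin_cases j <;> simp [mk]

lemma mk_one : mk 1 0 1 = 1 := Subtype.ext <| by simp [mk, Matrix.one_fin_two]

lemma exists_eq_mk (A : lowerTriRing) : ∃ q r s, A = mk q r s := by
  obtain ⟨q, hq⟩ := A.2.2
  refine ⟨q, A.1 1 0, A.1 1 1, Subtype.ext <| A.1.eta_fin_two.trans ?_⟩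
  rw [A.2.1, hq]
  rfl

/-- The presentation of the ring given by the two diagonal entries and the matrix unit below the
diagonal. -/
def presentation : TriangularPresentation lowerTriRing ℚ ℝ where
  iE :=
    { toFun := fun q => mk q 0 0
      map_mul' := fun a b => by simp [mk_mul]
      map_zero' := mk_zero
      map_add' := fun a b => by simp [mk_add] }
  iF :=
    { toFun := fun s => mk 0 0 s
      map_mul' := fun a b => by simp [mk_mul]
      map_zero' := mk_zero
      map_add' := fun a b => by simp [mk_add] }
  t := mk 0 1 0
  t_ne_zero h := by simpa [mk] using congrArg (fun A : lowerTriRing => A.1 1 0) h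
  one_add_one := by
    change mk 1 0 0 + mk 0 0 1 = 1
    simp [mk_add, mk_one]
  t_mul := by
    change mk 0 1 0 * mk 1 0 0 = mk 0 1 0
    simp [mk_mul]
  mul_t := by
    change mk 0 0 1 * mk 0 1 0 = mk 0 1 0
    simp [mk_mul]
  span A := by
    obtain ⟨q, r, s, rfl⟩ := exists_eq_mk A
    refine ⟨q, r, 1, s, ?_⟩
    change mk q r s = mk q 0 0 + mk 0 0 r * mk 0 1 0 * mk 1 0 0 + mk 0 0 s
    simp [mk_mul, mk_add]

lemma presentation_t_mul (q : ℚ) : presentation.t * presentation.iE q =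
    presentation.iF (Rat.castHom ℝ q) * presentation.t := by
  change mk 0 1 0 * mk q 0 0 = mk 0 0 (q : ℝ) * mk 0 1 0
  simp [mk_mul]

/-- The rational entry of a matrix. -/
noncomputable def ratEntry : lowerTriRing →+* ℚ where
  toFun A := A.2.2.choose
  map_one' := by
    have h := (1 : lowerTriRing).2.2.choose_spec
    have h₁ : (1 : lowerTriRing).1 0 0 = 1 := rfl
    exact_mod_cast h.symm.trans h₁
  map_mul' A B := by
    have h := (A * B).2.2.choose_spec
    have h₁ : (A * B).1 0 0 = A.1 0 0 * B.1 0 0 := by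
      simp [Matrix.mul_apply, Fin.sum_univ_two, A.2.1]
    rw [h, A.2.2.choose_spec, B.2.2.choose_spec] at h₁
    exact_mod_cast h₁
  map_zero' := by
    have h := (0 : lowerTriRing).2.2.choose_spec
    have h₁ : (0 : lowerTriRing).1 0 0 = 0 := rfl
    exact_mod_cast h.symm.trans h₁
  map_add' A B := by
    have h := (A + B).2.2.choose_spec
    have h₁ : (A + B).1 0 0 = A.1 0 0 + B.1 0 0 := rfl
    rw [h, A.2.2.choose_spec, B.2.2.choose_spec] at h₁
    exact_mod_cast h₁

@[simp] lemma ratEntry_mk (q : ℚ) (r s : ℝ) : ratEntry (mk q r s) = q := by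
  have h : (q : ℝ) = ratEntry (mk q r s) := (mk q r s).2.2.choose_spec
  exact_mod_cast h.symm

/-! ### Right modules attached to a rational linear map -/

variable {V : Type} [AddCommGroup V] [Module ℚ V]

/-- For a `ℚ`-linear map `h : ℝ → V`, the right module of row vectors `(x, y)` with `x` in `V` and
`y` real, on which `[[q, 0], [r, s]]` acts by `(x, y) ↦ (q x + h (y r), y s)`. -/
@[nolint unusedArguments]
def RowModule (_h : ℝ →ₗ[ℚ] V) : Type v := ULift.{v} (V × ℝ)

namespace RowModule

instance (h : ℝ →ₗ[ℚ] V) : AddCommGroup (RowModule.{v} h) :=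
  inferInstanceAs (AddCommGroup (ULift.{v} (V × ℝ)))

variable {h : ℝ →ₗ[ℚ] V}

/-- The row vector `(x, y)`. -/
def row (x : V) (y : ℝ) : RowModule.{v} h := ⟨(x, y)⟩

lemma exists_eq_row (m : RowModule.{v} h) : ∃ x y, m = row x y := ⟨m.down.1, m.down.2, rfl⟩

lemma row_inj {x x' : V} {y y' : ℝ} :
    (row x y : RowModule.{v} h) = row x' y' ↔ x = x' ∧ y = y' := by
  refine ⟨fun e => Prod.ext_iff.1 (congrArg ULift.down e), ?_⟩
  rintro ⟨rfl, rfl⟩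
  rfl

lemma row_zero : (row 0 0 : RowModule.{v} h) = 0 := rfl

noncomputable instance : Module lowerTriRingᵐᵒᵖ (RowModule.{v} h) where
  smul A m := row (ratEntry A.unop • m.down.1 + h (m.down.2 * A.unop.1 1 0))
    (m.down.2 * A.unop.1 1 1)
  one_smul m := row_inj.2 <| by simp
  mul_smul A B m := row_inj.2 <| by
    obtain ⟨A, rfl⟩ := MulOpposite.op_surjective A
    obtain ⟨B, rfl⟩ := MulOpposite.op_surjective B
    obtain ⟨q, r, s, rfl⟩ := exists_eq_mk A
    obtain ⟨q', r', s', rfl⟩ := exists_eq_mk B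
    obtain ⟨x, y, rfl⟩ := exists_eq_row m
    have hq : h (y * (r' * q)) = q • h (y * r') := by
      rw [← map_smul, Rat.smul_def]; ring_nf
    rw [← MulOpposite.op_mul, MulOpposite.unop_op, mk_mul]
    change ratEntry (mk _ _ _) • x + h (y * (r' * q + s' * r)) =
      ratEntry (mk _ _ _) • (ratEntry (mk _ _ _) • x + h (y * r')) + h (y * s' * r) ∧
      y * (s' * s) = y * s' * s
    simp only [ratEntry_mk]
    rw [mul_add, map_add, hq, smul_add, smul_smul, mul_comm q', ← add_assoc, mul_assoc y s' r]
    exact ⟨rfl, (mul_assoc _ _ _).symm⟩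
  smul_zero A := row_inj.2 <| by
    change _ • (0 : V) + h ((0 : ℝ) * _) = 0 ∧ (0 : ℝ) * _ = 0
    simp
  smul_add A m n := row_inj.2 <| by
    change _ • (m.down.1 + n.down.1) + h ((m.down.2 + n.down.2) * _) =
      (_ • m.down.1 + h (m.down.2 * _)) + (_ • n.down.1 + h (n.down.2 * _)) ∧
      (m.down.2 + n.down.2) * _ = m.down.2 * _ + n.down.2 * _
    rw [smul_add, add_mul, add_mul, map_add]
    exact ⟨by abel, rfl⟩
  add_smul A B m := row_inj.2 <| by
    change ratEntry (A.unop + B.unop) • m.down.1 + h (m.down.2 * (A.unop.1 1 0 + B.unop.1 1 0)) =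
      (_ • m.down.1 + h (m.down.2 * _)) + (_ • m.down.1 + h (m.down.2 * _)) ∧
      m.down.2 * (A.unop.1 1 1 + B.unop.1 1 1) = m.down.2 * _ + m.down.2 * _
    rw [map_add, mul_add, mul_add, map_add, add_smul]
    exact ⟨by abel, rfl⟩
  zero_smul m := row_inj.2 <| by simp

lemma op_mk_smul_row (q : ℚ) (r s : ℝ) (x : V) (y : ℝ) :
    (MulOpposite.op (mk q r s) • row x y : RowModule.{v} h) = row (q • x + h (y * r)) (y * s) := by
  change row (ratEntry (mk q r s) • x + h (y * r)) (y * s) = _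
  rw [ratEntry_mk]

lemma row_mem_src {x : V} {y : ℝ} :
    (row x y : RowModule.{v} h) ∈ presentation.op.src (RowModule.{v} h) ↔ x = 0 := by
  rw [TriangularPresentation.mem_src]
  change MulOpposite.op (mk 0 0 1) • (row x y : RowModule.{v} h) = _ ↔ _
  simp [op_mk_smul_row, row_inj, eq_comm]

lemma row_mem_tgt {x : V} {y : ℝ} :
    (row x y : RowModule.{v} h) ∈ presentation.op.tgt (RowModule.{v} h) ↔ y = 0 := by
  rw [TriangularPresentation.mem_tgt]
  change MulOpposite.op (mk 1 0 0) • (row x y : RowModule.{v} h) = _ ↔ _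
  simp [op_mk_smul_row, row_inj, eq_comm]

lemma arrow_row {y : ℝ} (hy : row 0 y ∈ presentation.op.src (RowModule.{v} h)) :
    (presentation.op.arrow (RowModule.{v} h) ⟨row 0 y, hy⟩ : RowModule.{v} h) = row (h y) 0 := by
  change MulOpposite.op (mk 0 1 0) • (row 0 y : RowModule.{v} h) = _
  simp [op_mk_smul_row]

lemma isInjectiveRel_self {h : ℝ →ₗ[ℚ] ℚ} (hh : Function.Surjective h) :
    IsInjectiveRel lowerTriRingᵐᵒᵖ (RowModule.{v} h) (RowModule.{v} h) := by
  refine presentation.op.isInjectiveRel_self (Rat.castHom ℝ)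
    (fun a => congrArg MulOpposite.op (presentation_t_mul a)) ?_
    ⟨row 0 1, row_mem_src.2 rfl⟩ ?_ ⟨row 1 0, row_mem_tgt.2 rfl⟩ ?_
  · rintro ⟨m, hm⟩
    obtain ⟨x, y, rfl⟩ := exists_eq_row m
    obtain rfl := row_mem_tgt.1 hm
    obtain ⟨r, rfl⟩ := hh x
    exact ⟨⟨row 0 r, row_mem_src.2 rfl⟩, Subtype.ext (arrow_row _)⟩
  · rintro ⟨m, hm⟩
    obtain ⟨x, y, rfl⟩ := exists_eq_row m
    obtain rfl := row_mem_src.1 hm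
    refine ⟨y, Subtype.ext ?_⟩
    change MulOpposite.op (mk 0 0 y) • (row 0 1 : RowModule.{v} h) = _
    simp [op_mk_smul_row]
  · rintro ⟨m, hm⟩
    obtain ⟨x, y, rfl⟩ := exists_eq_row m
    obtain rfl := row_mem_tgt.1 hm
    refine ⟨x, Subtype.ext ?_⟩
    change MulOpposite.op (mk x 0 0) • (row 1 0 : RowModule.{v} h) = _
    simp [op_mk_smul_row]

/-- A map from the module of all real rows extending a functional `δ` on the first entries is
determined by the image of `(0, 1)`, whose second entry is the `b` with `δ = h (b ·)`. -/
lemma exists_forall_eq_of_isInjectiveRel {h : ℝ →ₗ[ℚ] ℚ}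
    (H : IsInjectiveRel lowerTriRingᵐᵒᵖ (RowModule.{v} h)
      (RowModule.{v} (LinearMap.id : ℝ →ₗ[ℚ] ℝ))) (δ : ℝ →ₗ[ℚ] ℚ) :
    ∃ b, ∀ r, δ r = h (b * r) := by
  let W := presentation.op.tgtSubmodule (RowModule.{v} (LinearMap.id : ℝ →ₗ[ℚ] ℝ))
  have hW {x y : ℝ} : row x y ∈ W ↔ y = 0 := by
    change MulOpposite.op (mk 0 0 1) • row x y = 0 ↔ _
    simp [op_mk_smul_row, ← row_zero, row_inj]
  let φ : W →ₗ[lowerTriRingᵐᵒᵖ] RowModule.{v} h :=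
    { toFun := fun m => row (δ m.1.down.1) 0
      map_add' := fun m n => row_inj.2 ⟨map_add δ _ _, (add_zero 0).symm⟩
      map_smul' := by
        rintro A ⟨m, hm⟩
        obtain ⟨A, rfl⟩ := MulOpposite.op_surjective A
        obtain ⟨q, r, s, rfl⟩ := exists_eq_mk A
        obtain ⟨x, y, rfl⟩ := exists_eq_row m
        obtain rfl := hW.1 hm
        have h₁ := op_mk_smul_row.{v} (h := LinearMap.id) q r s x 0
        change row (δ (MulOpposite.op (mk q r s) • (row x 0 : RowModule.{v} _)).down.1) 0 =
          MulOpposite.op (mk q r s) • row (δ x) 0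
        rw [h₁, op_mk_smul_row]
        refine row_inj.2 ?_
        simp [row] }
  obtain ⟨ψ, hψ⟩ := H W φ
  obtain ⟨a, b, hab⟩ := exists_eq_row (ψ (row 0 1))
  refine ⟨b, fun r => ?_⟩
  have h₁ : ψ (row r 0) = row (δ r) 0 := hψ ⟨row r 0, hW.2 rfl⟩
  have h₂ : (row r 0 : RowModule.{v} (LinearMap.id : ℝ →ₗ[ℚ] ℝ)) =
      MulOpposite.op (mk 0 r 0) • row 0 1 := by simp [op_mk_smul_row]
  rw [h₂, map_smul, hab, op_mk_smul_row, row_inj] at h₁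
  simpa using h₁.1.symm

end RowModule

/-- The space of rational functionals on `ℝ` has rational dimension larger than that of `ℝ`. -/
lemma exists_dual_ne (h : ℝ →ₗ[ℚ] ℚ) : ∃ δ : ℝ →ₗ[ℚ] ℚ, ∀ b, ∃ r, δ r ≠ h (b * r) := by
  by_contra! H
  let f : ℝ →ₗ[ℚ] (ℝ →ₗ[ℚ] ℚ) := LinearMap.llcomp ℚ ℝ ℝ ℚ h ∘ₗ LinearMap.mul ℚ ℝ
  have hf : Function.Surjective f := fun δ => by
    obtain ⟨b, hb⟩ := H δ
    exact ⟨b, LinearMap.ext fun r => (hb r).symm⟩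
  refine (f.rank_le_of_surjective hf).not_gt (rank_lt_rank_dual ?_)
  rw [Real.rank_rat_real]
  exact Cardinal.aleph0_le_continuum

lemma not_hasNoRightIMiddleClass : ¬ HasNoRightIMiddleClass.{0, v} lowerTriRing := by
  intro H
  obtain ⟨h, hh⟩ := Module.Projective.exists_dual_eq_one ℚ (one_ne_zero (α := ℝ))
  have hsurj : Function.Surjective h := fun q => ⟨q • 1, by rw [map_smul, hh, smul_eq_mul, mul_one]⟩
  let M : ModuleCat.{v} lowerTriRingᵐᵒᵖ := ModuleCat.of _ (RowModule.{v} h)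
  have hself : M ∈ injectivityDomain _ M := RowModule.isInjectiveRel_self hsurj
  have hM : M ∉ semisimpleModules _ := fun (hM : IsSemisimpleModule _ (RowModule.{v} h)) => by
    have := congrArg Subtype.val (presentation.op.arrow_eq_zero_of_isSemisimpleModule
      (⟨.row 0 1, RowModule.row_mem_src.2 rfl⟩ : presentation.op.src (RowModule.{v} h)))
    rw [RowModule.arrow_row, hh] at this
    exact one_ne_zero (RowModule.row_inj.1 this).1
  obtain h₁ | h₁ : _ ∨ _ := H.subset ⟨M, rfl⟩
  · exact hM (h₁ ▸ hself)
  · obtain ⟨δ, hδ⟩ := exists_dual_ne h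
    obtain ⟨b, hb⟩ := RowModule.exists_forall_eq_of_isInjectiveRel (h₁.ge (Set.mem_univ
      (ModuleCat.of _ (RowModule.{v} (LinearMap.id : ℝ →ₗ[ℚ] ℝ))))) δ
    obtain ⟨r, hr⟩ := hδ b
    exact hr (hb r)

end lowerTriRing

theorem proposition4p9 :
    ¬ IsSemisimpleRing lowerTriRing ∧
    HasNoLeftIMiddleClass.{0, v} lowerTriRing ∧
    HasNoRightPMiddleClass.{0, v} lowerTriRing ∧
    HasNoLeftPMiddleClass.{0, v} lowerTriRing ∧
    ¬ HasNoRightIMiddleClass.{0, v} lowerTriRing :=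
  ⟨lowerTriRing.presentation.not_isSemisimpleRing,
    lowerTriRing.presentation.leftIProfile_eq _ lowerTriRing.presentation_t_mul,
    lowerTriRing.presentation.op.leftPProfile_eq_of_map_tgt (Rat.castHom ℝ)
      fun a => congrArg MulOpposite.op (lowerTriRing.presentation_t_mul a),
    lowerTriRing.presentation.leftPProfile_eq_of_map_src _ lowerTriRing.presentation_t_mul,
    lowerTriRing.not_hasNoRightIMiddleClass⟩
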